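/- Let $\Omega\subset\mathbb{C}^n$ be a Reinhardt domain (a nonempty connected open set such that $z\in\Omega$ and $|w_j|=|z_j|$ for all $j$ imply $w\in\Omega$) such that the origin is a boundary point of $\Omega$. Call a Reinhardt domain $D$ complete if $z\in D$ and $|w_j|\le|z_j|$ for all $j$ imply $w\in D$, and log-convex if the set $\{(\log|z_1|,\dots,\log|z_n|) : z\in D,\ z_1\cdots z_n\neq 0\}\subset\mathbb{R}^n$ is convex. Let $\mathcal{O}(\Omega)$ be the space of holomorphic functions on $\Omega$, and let $\mathcal{C}^\infty(\overline\Omega)$ be the space of smooth functions on $\Omega$ whose partial derivatives of all orders (with respect to the real coordinates of $\mathbb{C}^n$) extend continuously to $\overline\Omega$. Then there is a smallest complete log-convex Reinhardt domain $\widehat\Omega$ containing $\Omega$, and every $f\in\mathcal{C}^\infty(\overline\Omega)\cap\mathcal{O}(\Omega)$ extends to a holomorphic function $F$ on $\widehat\Omega$. The extension is given by the Taylor series of $f$ at the origin: for every $\alpha\in\mathbb{N}^n$ the derivative $\partial^\alpha f(z)$ tends to $\partial^\alpha F(0)$ as $z\to 0$, $z\in\Omega$, and $$F(z)=\sum_{\alpha\in\mathbb{N}^n}\frac{\partial^\alpha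 F(0)}{\alpha!}\,z^\alpha\qquad\text{for all } z\in\widehat\Omega,$$ the series being absolutely convergent at every point of $\widehat\Omega$. -/

import Mathlib

open Set Filter Topology
open scoped ContDiff

/-- A domain: a nonempty connected open subset of `ℂⁿ`. -/
def IsDomainSet {n : ℕ} (D : Set (Fin n → ℂ)) : Prop :=
  IsOpen D ∧ IsConnected D

/-- A Reinhardt set: membership depends only on the moduli of the coordinates. -/
def IsReinhardt {n : ℕ} (D : Set (Fin n → ℂ)) : Prop :=
  ∀ z ∈ D, ∀ w : Fin n → ℂ, (∀ j, ‖w j‖ = ‖z j‖) → w ∈ D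

/-- A complete Reinhardt set: with a point it contains the closed polydisc centred at the origin
whose polyradius is given by the moduli of the coordinates of that point. -/
def IsCompleteReinhardt {n : ℕ} (D : Set (Fin n → ℂ)) : Prop :=
  ∀ z ∈ D, ∀ w : Fin n → ℂ, (∀ j, ‖w j‖ ≤ ‖z j‖) → w ∈ D

/-- The image in `ℝⁿ` of a set under `z ↦ (log |z₁|, …, log |zₙ|)`, a map which is defined
at the points with no vanishing coordinate. -/
def logImage {n : ℕ} (D : Set (Fin n → ℂ)) : Set (Fin n → ℝ) :=
  (fun (z : Fin n → ℂ) (j : Fin n) => Real.log ‖z j‖) '' {z | z ∈ D ∧ ∀ j, z j ≠ 0}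

/-- Logarithmic convexity. -/
def IsLogConvex {n : ℕ} (D : Set (Fin n → ℂ)) : Prop :=
  Convex ℝ (logImage D)

/-- A complete log-convex Reinhardt domain. -/
def IsCompleteLogConvexReinhardtDomain {n : ℕ} (D : Set (Fin n → ℂ)) : Prop :=
  IsDomainSet D ∧ IsReinhardt D ∧ IsCompleteReinhardt D ∧ IsLogConvex D

/-- The iterated directional derivative `∂_{v₁} ∂_{v₂} ⋯ ∂_{vₖ} f` for `L = [v₁, …, vₖ]`, over the
scalar field `𝕜` (real or complex derivatives). -/
noncomputable def iterDirDeriv (𝕜 : Type*) [NontriviallyNormedField 𝕜] {E F : Type*}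
    [NormedAddCommGroup E] [NormedSpace 𝕜 E] [NormedAddCommGroup F] [NormedSpace 𝕜 F]
    (L : List E) (f : E → F) : E → F :=
  L.foldr (fun v g z => fderiv 𝕜 g z v) f

/-- The real coordinate directions of `ℂⁿ = ℝ²ⁿ`: those of `xⱼ` and `yⱼ`, where `zⱼ = xⱼ + i yⱼ`. -/
def realCoordDirs (n : ℕ) : Set (Fin n → ℂ) :=
  {v | ∃ j : Fin n, v = Pi.single j 1 ∨ v = Pi.single j Complex.I}

/-- The space `C^∞(closure Ω)`: smooth functions on `Ω` (in the real sense) all of whose partial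
derivatives, of all orders, extend continuously to the closure of `Ω`. -/
def SmoothUpToBoundary {n : ℕ} (Ω : Set (Fin n → ℂ)) (f : (Fin n → ℂ) → ℂ) : Prop :=
  ContDiffOn ℝ ∞ f Ω ∧
    ∀ L : List (Fin n → ℂ), (∀ v ∈ L, v ∈ realCoordDirs n) →
      ∃ g : (Fin n → ℂ) → ℂ, ContinuousOn g (closure Ω) ∧ EqOn g (iterDirDeriv ℝ L f) Ω

/-- The complex partial derivative `∂^α f = (∂/∂z₁)^α₁ ⋯ (∂/∂zₙ)^αₙ f`. -/
noncomputable def complexPartial {n : ℕ} (α : Fin n → ℕ) (f : (Fin n → ℂ) → ℂ) :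
    (Fin n → ℂ) → ℂ :=
  iterDirDeriv ℂ
    ((List.finRange n).flatMap fun j => List.replicate (α j) (Pi.single j (1 : ℂ))) f

/-! The torus acts on `Ω` by rotating coordinates. Averaging `f` against the character of weight `α
∈ ℤⁿ` gives a holomorphic component `laurentTerm f α`. Off the coordinate hyperplanes it equals `c_α
z^α`, with `c_α` independent of `z` because `Ω` stays connected there (`laurentCoeff_eq`).

The boundary point `0` kills every `c_α` with a negative exponent (`laurentCoeff_eq_zero`). If no
exponent is positive, the component is bounded near `0` while `|z^α| ≥ 1/‖z‖`, so `c_α = 0`. A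
positive `α_j` is lowered by differentiating: `∂_j f` has coefficient `α_j c_α` at `α - e_j`, and it
again has bounded derivatives near `0`. This is where smoothness up to the boundary enters.

So `f` is a power series on `Ω`. The points where its terms are bounded form a complete log-convex
Reinhardt set. The interior of that set contains `Ω`, hence the hull, and by Abel's lemma the series
converges there to a holomorphic `F`. The same coefficient calculus for `F` on the hull, which
contains `0`, identifies `c_α` with `∂^α F(0)/α!`. -/

open MeasureTheory Metric

/-! ### Holomorphic functions on normed spaces: series, parameter integrals, derivatives. -/

section Holomorphic

/-- A tube-lemma argument: compactness of `C` makes continuity in the parameter uniform in `z`, as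
Cauchy's estimate requires. -/
theorem exists_norm_sub_le_of_continuousOn_prod {E X : Type*} [TopologicalSpace E]
    [TopologicalSpace X] {K : Set X} {G : E → X → ℂ} {C : Set E} (hC : IsCompact C)
    (hG : ContinuousOn (Function.uncurry G) (C ×ˢ K)) {x : X} (hx : x ∈ K) {ε : ℝ} (hε : 0 < ε) :
    ∀ᶠ y in 𝓝[K] x, ∀ z ∈ C, ‖G z y - G z x‖ ≤ ε := by
  rw [eventually_nhdsWithin_iff]
  have h := hC.eventually_forall_of_forall_eventually (x₀ := x)
    (P := fun y z => y ∈ K → z ∈ C → ‖G z y - G z x‖ ≤ ε) fun z hz => by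
      have h1 : Tendsto (fun p : X × E => G p.2 p.1 - G p.2 x) (𝓝[K ×ˢ C] (x, z)) (𝓝 0) := by
        have e1 : ContinuousWithinAt (fun p : X × E => G p.2 p.1) (K ×ˢ C) (x, z) :=
          (hG (z, x) ⟨hz, hx⟩).comp (f := fun p : X × E => (p.2, p.1)) (x := (x, z))
            (by fun_prop) fun p hp => ⟨hp.2, hp.1⟩
        have e2 : ContinuousWithinAt (fun p : X × E => G p.2 x) (K ×ˢ C) (x, z) :=
          (hG (z, x) ⟨hz, hx⟩).comp (f := fun p : X × E => (p.2, x)) (x := (x, z))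
            (by fun_prop) fun p hp => ⟨hp.2, hx⟩
        simpa [Pi.sub_def] using (e1.sub e2).tendsto
      have h2 := h1.norm.eventually (Iic_mem_nhds (by simpa using hε) : Iic ε ∈ 𝓝 ‖(0 : ℂ)‖)
      rw [eventually_nhdsWithin_iff] at h2
      filter_upwards [h2] with p hp h3 h4 using hp ⟨h3, h4⟩
  filter_upwards [h] with y hy hyK z hz using hy z hz hyK hz

variable {E : Type*} [NormedAddCommGroup E] [NormedSpace ℂ E]

/-- Cauchy's estimate for the Fréchet derivative. -/
theorem norm_fderiv_le_of_norm_le_ball {f : E → ℂ} {c : E} {R M : ℝ} (hR : 0 < R)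
    (hd : DifferentiableOn ℂ f (ball c R)) (hM : ∀ z ∈ ball c R, ‖f z‖ ≤ M) :
    ‖fderiv ℂ f c‖ ≤ 2 * M / R := by
  -- The target ball is centred at `f c`, not at `0`; hence the factor 2.
  refine Complex.norm_fderiv_le_div_of_mapsTo_ball hd (fun z hz => ?_) hR
  rw [mem_closedBall, dist_eq_norm]
  have h1 := hM z hz
  have h2 := hM c (mem_ball_self hR)
  calc ‖f z - f c‖ ≤ ‖f z‖ + ‖f c‖ := norm_sub_le _ _
    _ ≤ 2 * M := by linarith

/-- A series of holomorphic functions with a summable uniform bound is holomorphic. -/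
theorem differentiableOn_tsum_of_summable_norm_le {ι : Type*} {u : ι → ℝ} (hu : Summable u)
    {U : Set E} (hU : IsOpen U) {F : ι → E → ℂ} (hF : ∀ i, DifferentiableOn ℂ (F i) U)
    (hb : ∀ i, ∀ z ∈ U, ‖F i z‖ ≤ u i) :
    DifferentiableOn ℂ (fun z => ∑' i, F i z) U := by
  intro z hz
  obtain ⟨r, hr, hrU⟩ := Metric.isOpen_iff.1 hU z hz
  -- Halving the radius leaves a ball of fixed size around each nearby `w`, so Cauchy's estimate
  -- bounds all derivatives by one summable sequence.
  have hsub : ∀ w ∈ ball z (r / 2), ball w (r / 2) ⊆ U := fun w hw =>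
    (ball_subset_ball' (by have := mem_ball.1 hw; linarith)).trans hrU
  have hhalf : 0 < r / 2 := by positivity
  have hmem : ∀ w ∈ ball z (r / 2), w ∈ U := fun w hw => hsub w hw (mem_ball_self hhalf)
  let _ : NormedSpace ℝ E := NormedSpace.restrictScalars ℝ ℂ E
  have key := hasFDerivAt_tsum_of_isPreconnected (𝕜 := ℂ) (f := F)
    (f' := fun i w => fderiv ℂ (F i) w) (u := fun i => 2 * u i / (r / 2)) (s := ball z (r / 2))
    ((hu.mul_left 2).div_const _) isOpen_ball (convex_ball z (r / 2)).isPreconnected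
    (fun i w hw => ((hF i).differentiableAt (hU.mem_nhds (hmem w hw))).hasFDerivAt)
    (fun i w hw => norm_fderiv_le_of_norm_le_ball hhalf ((hF i).mono (hsub w hw))
      fun y hy => hb i y (hsub w hw hy))
    (mem_ball_self hhalf) (Summable.of_norm_bounded hu fun i => hb i z hz) (mem_ball_self hhalf)
  exact key.differentiableAt.differentiableWithinAt

section Param

variable [ProperSpace E] {X : Type*} [TopologicalSpace X] {K : Set X} {U : Set E} {G : E → X → ℂ}

theorem continuousOn_fderiv_of_param (hU : IsOpen U)
    (hG : ContinuousOn (Function.uncurry G) (U ×ˢ K))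
    (hd : ∀ x ∈ K, DifferentiableOn ℂ (fun z => G z x) U) {z : E} (hz : z ∈ U) :
    ContinuousOn (fun x => fderiv ℂ (fun w => G w x) z) K := by
  obtain ⟨r, hr, hrU⟩ := Metric.nhds_basis_closedBall.mem_iff.1 (hU.mem_nhds hz)
  intro x hx
  rw [ContinuousWithinAt, Metric.tendsto_nhds]
  intro ε hε
  -- Cauchy's estimate on radius `r` turns this bound into `ε / 2`.
  have hbase : (0 : ℝ) < ε * r / 4 := by positivity
  filter_upwards [exists_norm_sub_le_of_continuousOn_prod (isCompact_closedBall z r)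
    (hG.mono (prod_mono_left hrU)) hx hbase, self_mem_nhdsWithin] with y hy hyK
  have hdy := (hd y hyK).differentiableAt (hU.mem_nhds hz)
  have hdx := (hd x hx).differentiableAt (hU.mem_nhds hz)
  have hbU : ball z r ⊆ U := ball_subset_closedBall.trans hrU
  rw [dist_eq_norm, ← fderiv_fun_sub hdy hdx]
  have := norm_fderiv_le_of_norm_le_ball hr
    (((hd y hyK).mono hbU).fun_sub ((hd x hx).mono hbU))
    fun w hw => hy w (ball_subset_closedBall hw)
  refine this.trans_lt ?_
  rw [div_lt_iff₀ hr]
  nlinarith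

variable [MeasurableSpace X] [OpensMeasurableSpace X] {μ : Measure X}
  [IsFiniteMeasureOnCompacts μ]

/-- Differentiation under the integral sign for holomorphic integrands over a compact set. -/
theorem hasFDerivAt_setIntegral_of_param (hK : IsCompact K) (hKm : MeasurableSet K)
    (hU : IsOpen U) (hG : ContinuousOn (Function.uncurry G) (U ×ˢ K))
    (hd : ∀ x ∈ K, DifferentiableOn ℂ (fun z => G z x) U) {z : E} (hz : z ∈ U) :
    HasFDerivAt (fun w => ∫ x in K, G w x ∂μ) (∫ x in K, fderiv ℂ (fun w => G w x) z ∂μ) z := by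
  obtain ⟨r, hr, hrU⟩ := Metric.nhds_basis_closedBall.mem_iff.1 (hU.mem_nhds hz)
  have hcont : ∀ w ∈ U, ContinuousOn (G w) K := fun w hw =>
    hG.comp (f := fun x => (w, x)) (by fun_prop) fun x hx => ⟨hw, hx⟩
  obtain ⟨M, hM⟩ := ((isCompact_closedBall z r).prod hK).exists_bound_of_continuousOn
    (hG.mono (prod_mono_left hrU))
  have hhalf : 0 < r / 2 := by positivity
  have : IsFiniteMeasure (μ.restrict K) := ⟨by simpa using hK.measure_lt_top⟩
  have hsub : ∀ w ∈ ball z (r / 2), ball w (r / 2) ⊆ closedBall z r := fun w hw =>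
    (ball_subset_ball' (by have := mem_ball.1 hw; linarith)).trans ball_subset_closedBall
  refine hasFDerivAt_integral_of_dominated_of_fderiv_le (𝕜 := ℂ) (μ := μ.restrict K)
    (F' := fun w x => fderiv ℂ (fun w => G w x) w)
    (bound := fun _ => 2 * M / (r / 2)) (ball_mem_nhds z hhalf) ?_ ?_ ?_ ?_ ?_ ?_
  · filter_upwards [hU.mem_nhds hz] with w hw
    exact (hcont w hw).aestronglyMeasurable_of_isCompact hK hKm
  · exact (hcont z hz).integrableOn_compact' hK hKm
  · exact (continuousOn_fderiv_of_param hU hG hd hz).aestronglyMeasurable_of_isCompact hK hKm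
  · refine (ae_restrict_iff' hKm).2 (Eventually.of_forall fun x hx w hw => ?_)
    exact norm_fderiv_le_of_norm_le_ball hhalf ((hd x hx).mono ((hsub w hw).trans hrU))
      fun y hy => hM (y, x) ⟨hsub w hw hy, hx⟩
  · exact integrable_const _
  · refine (ae_restrict_iff' hKm).2 (Eventually.of_forall fun x hx w hw => ?_)
    have hwU : w ∈ U := hrU (hsub w hw (mem_ball_self hhalf))
    exact ((hd x hx).differentiableAt (hU.mem_nhds hwU)).hasFDerivAt

theorem fderiv_setIntegral_of_param_apply (hK : IsCompact K) (hKm : MeasurableSet K)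
    (hU : IsOpen U) (hG : ContinuousOn (Function.uncurry G) (U ×ˢ K))
    (hd : ∀ x ∈ K, DifferentiableOn ℂ (fun z => G z x) U) {z : E} (hz : z ∈ U) (v : E) :
    fderiv ℂ (fun w => ∫ x in K, G w x ∂μ) z v =
      ∫ x in K, fderiv ℂ (fun w => G w x) z v ∂μ := by
  rw [(hasFDerivAt_setIntegral_of_param hK hKm hU hG hd hz).fderiv]
  exact ContinuousLinearMap.integral_apply
    ((continuousOn_fderiv_of_param hU hG hd hz).integrableOn_compact' hK hKm) v

end Param

/-- Directional derivatives of holomorphic functions are holomorphic. -/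
theorem differentiableOn_fderiv_apply [ProperSpace E] {U : Set E} (hU : IsOpen U)
    {f : E → ℂ} (hf : DifferentiableOn ℂ f U) (v : E) :
    DifferentiableOn ℂ (fun z => fderiv ℂ f z v) U := by
  intro z hz
  obtain ⟨r, hr, hrU⟩ := Metric.isOpen_iff.1 hU z hz
  obtain ⟨ρ, hρ, hρv⟩ : ∃ ρ : ℝ, 0 < ρ ∧ ρ * ‖v‖ < r / 2 := by
    refine ⟨r / 2 / (‖v‖ + 1), by positivity, ?_⟩
    rw [div_mul_eq_mul_div, div_lt_iff₀ (by positivity)]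
    nlinarith
  have hmem : ∀ w ∈ ball z (r / 2), ∀ ζ ∈ closedBall (0 : ℂ) ρ, w + ζ • v ∈ U := by
    intro w hw ζ hζ
    refine hrU ?_
    rw [mem_ball, dist_eq_norm] at hw ⊢
    rw [mem_closedBall_zero_iff] at hζ
    calc ‖w + ζ • v - z‖ = ‖(w - z) + ζ • v‖ := by congr 1; abel
      _ ≤ ‖w - z‖ + ‖ζ‖ * ‖v‖ := (norm_add_le _ _).trans (by rw [norm_smul])
      _ ≤ ‖w - z‖ + ρ * ‖v‖ := by gcongr
      _ < r := by linarith
  have hline : ∀ w ∈ ball z (r / 2), ∀ ζ ∈ closedBall (0 : ℂ) ρ,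
      HasDerivAt (fun ζ : ℂ => f (w + ζ • v)) (fderiv ℂ f (w + ζ • v) v) ζ := by
    intro w hw ζ hζ
    have h1 := (hf.differentiableAt (hU.mem_nhds (hmem w hw ζ hζ))).hasFDerivAt
    have h2 : HasDerivAt (fun ζ : ℂ => w + ζ • v) v ζ := by
      simpa using ((hasDerivAt_id ζ).smul_const v).const_add w
    exact h1.comp_hasDerivAt ζ h2
  -- Integrand of Cauchy's formula for the derivative at `0` of `ζ ↦ f (w + ζ • v)`. The directional
  -- derivative becomes a parameter integral of a function holomorphic in `w`.
  set G : E → ℝ → ℂ := fun w θ => deriv (circleMap 0 ρ) θ •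
    (((circleMap 0 ρ θ) ^ 2)⁻¹ • f (w + circleMap 0 ρ θ • v)) with hGdef
  have hcm : ∀ θ, circleMap 0 ρ θ ∈ closedBall (0 : ℂ) ρ := fun θ =>
    circleMap_mem_closedBall 0 hρ.le θ
  have hcm0 : ∀ θ, circleMap 0 ρ θ ≠ 0 := fun θ => circleMap_ne_center hρ.ne'
  have hrepr : EqOn (fun w => fderiv ℂ f w v)
      (fun w => (2 * Real.pi * Complex.I : ℂ)⁻¹ • ∫ θ in Icc 0 (2 * Real.pi), G w θ)
      (ball z (r / 2)) := by
    intro w hw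
    have h0 : (0 : ℂ) ∈ closedBall (0 : ℂ) ρ := mem_closedBall_self hρ.le
    have hD : (fderiv ℂ f w v) = deriv (fun ζ : ℂ => f (w + ζ • v)) 0 := by
      have := (hline w hw 0 h0).deriv
      simpa using this.symm
    have hcd : DiffContOnCl ℂ (fun ζ : ℂ => f (w + ζ • v)) (ball 0 ρ) := by
      refine DifferentiableOn.diffContOnCl ?_
      rw [closure_ball _ hρ.ne']
      exact fun ζ hζ => (hline w hw ζ hζ).differentiableAt.differentiableWithinAt
    change fderiv ℂ f w v = _
    rw [hD, eq_inv_smul_iff₀ Complex.two_pi_I_ne_zero, ← hcd.deriv_eq_smul_circleIntegral hρ,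
      circleIntegral, intervalIntegral.integral_of_le Real.two_pi_pos.le,
      integral_Icc_eq_integral_Ioc]
    simp [hGdef]
  have hGc : ContinuousOn (Function.uncurry G) (ball z (r / 2) ×ˢ Icc 0 (2 * Real.pi)) := by
    have h1 : Continuous fun p : E × ℝ => circleMap 0 ρ p.2 :=
      (continuous_circleMap 0 ρ).comp continuous_snd
    have h2 : ContinuousOn (fun p : E × ℝ => f (p.1 + circleMap 0 ρ p.2 • v))
        (ball z (r / 2) ×ˢ Icc 0 (2 * Real.pi)) :=
      hf.continuousOn.comp (by fun_prop) fun p hp => hmem _ hp.1 _ (hcm _)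
    have h3 : Continuous fun p : E × ℝ => ((circleMap 0 ρ p.2) ^ 2)⁻¹ :=
      (h1.pow 2).inv₀ fun p => pow_ne_zero _ (hcm0 _)
    have h4 : Continuous fun p : E × ℝ => deriv (circleMap 0 ρ) p.2 := by
      simp only [deriv_circleMap]; fun_prop
    exact h4.continuousOn.smul (h3.continuousOn.smul h2)
  have hGd : ∀ θ ∈ Icc 0 (2 * Real.pi), DifferentiableOn ℂ (fun w => G w θ) (ball z (r / 2)) := by
    intro θ _
    have h1 : DifferentiableOn ℂ (fun w => f (w + circleMap 0 ρ θ • v)) (ball z (r / 2)) :=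
      hf.comp (differentiableOn_id.add_const _) fun w hw => hmem w hw _ (hcm θ)
    exact (h1.const_smul ((circleMap 0 ρ θ ^ 2)⁻¹)).const_smul (deriv (circleMap 0 ρ) θ)
  have hzb : z ∈ ball z (r / 2) := mem_ball_self (by positivity)
  have hfin := ((hasFDerivAt_setIntegral_of_param (μ := volume) isCompact_Icc measurableSet_Icc
    isOpen_ball hGc hGd hzb).differentiableAt.const_smul (2 * Real.pi * Complex.I : ℂ)⁻¹)
  exact (hfin.congr_of_eventuallyEq
    (hrepr.eventuallyEq_of_mem (isOpen_ball.mem_nhds hzb))).differentiableWithinAt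

end Holomorphic

/-! ### Complete log-convex Reinhardt domains and the hull. -/

section Geometry

variable {n : ℕ} {D : Set (Fin n → ℂ)}

theorem IsCompleteReinhardt.isReinhardt (hD : IsCompleteReinhardt D) : IsReinhardt D :=
  fun z hz w hw => hD z hz w fun j => (hw j).le

theorem exists_norm_eq_norm_add (a : ℂ) {ε : ℝ} (hε : 0 < ε) :
    ∃ b : ℂ, ‖b - a‖ = ε ∧ ‖b‖ = ‖a‖ + ε := by
  rcases eq_or_ne a 0 with rfl | ha
  · exact ⟨(ε : ℂ), by simp [hε.le], by simp [hε.le]⟩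
  · have ha' : 0 < ‖a‖ := norm_pos_iff.2 ha
    refine ⟨a + (ε / ‖a‖ : ℝ) * a, ?_, ?_⟩
    · rw [add_sub_cancel_left, norm_mul, Complex.norm_real, Real.norm_of_nonneg (by positivity)]
      field_simp
    · have : a + (ε / ‖a‖ : ℝ) * a = (1 + ε / ‖a‖ : ℝ) * a := by push_cast; ring
      rw [this, norm_mul, Complex.norm_real, Real.norm_of_nonneg (by positivity)]
      field_simp

/-- Points of an open set can be moved outwards in all coordinates. -/
theorem exists_mem_norm_eq_norm_add {U : Set (Fin n → ℂ)} {z : Fin n → ℂ} (hU : U ∈ 𝓝 z) :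
    ∃ ε > 0, ∃ w ∈ U, ∀ j, ‖w j‖ = ‖z j‖ + ε := by
  obtain ⟨δ, hδ, hball⟩ := Metric.mem_nhds_iff.1 hU
  choose w hw1 hw2 using fun j => exists_norm_eq_norm_add (z j) (half_pos hδ)
  refine ⟨δ / 2, half_pos hδ, w, hball ?_, hw2⟩
  rw [mem_ball, dist_pi_lt_iff hδ]
  intro j
  rw [dist_eq_norm, hw1]
  linarith

theorem IsCompleteReinhardt.mem_interior_of_norm_lt (hD : IsCompleteReinhardt D)
    {z w : Fin n → ℂ} (hw : w ∈ D) (h : ∀ j, ‖z j‖ < ‖w j‖) : z ∈ interior D := by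
  rw [mem_interior]
  refine ⟨{y | ∀ j, ‖y j‖ < ‖w j‖}, fun y hy => hD w hw y fun j => (hy j).le, ?_, h⟩
  simp only [ofPred_forall]
  exact isOpen_iInter_of_finite fun j =>
    isOpen_lt ((continuous_apply j).norm) continuous_const

theorem IsCompleteReinhardt.interior_set (hD : IsCompleteReinhardt D) :
    IsCompleteReinhardt (interior D) := by
  intro z hz w hw
  obtain ⟨ε, hε, y, hy, hyz⟩ := exists_mem_norm_eq_norm_add (mem_interior_iff_mem_nhds.1 hz)
  exact hD.mem_interior_of_norm_lt hy fun j => by linarith [hw j, hyz j]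

theorem IsReinhardt.mem_logImage_iff (hD : IsReinhardt D) (x : Fin n → ℝ) :
    x ∈ logImage D ↔ (fun j => (Real.exp (x j) : ℂ)) ∈ D := by
  constructor
  · rintro ⟨z, ⟨hz, hz0⟩, rfl⟩
    refine hD z hz _ fun j => ?_
    rw [Complex.norm_real, Real.norm_of_nonneg (Real.exp_pos _).le,
      Real.exp_log (norm_pos_iff.2 (hz0 j))]
  · refine fun h => ⟨_, ⟨h, fun j => ?_⟩, ?_⟩
    · exact Complex.ofReal_ne_zero.2 (Real.exp_pos _).ne'
    · ext j
      simp only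
      rw [Complex.norm_real, Real.norm_of_nonneg (Real.exp_pos _).le, Real.log_exp]

/-- For a complete set, interior points are those that can be pushed outwards along the diagonal in
logarithmic coordinates. This description passes to convex combinations. -/
theorem IsCompleteReinhardt.mem_logImage_interior_iff (hD : IsCompleteReinhardt D)
    (x : Fin n → ℝ) :
    x ∈ logImage (interior D) ↔ ∃ ε > 0, (fun j => x j + ε) ∈ logImage D := by
  rw [hD.interior_set.isReinhardt.mem_logImage_iff]
  constructor
  · intro h
    have hc : ContinuousAt (fun ε : ℝ => fun j => (Real.exp (x j + ε) : ℂ)) 0 := by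
      refine Continuous.continuousAt ?_
      fun_prop
    have h0 : D ∈ 𝓝 ((fun ε : ℝ => fun j => (Real.exp (x j + ε) : ℂ)) 0) := by
      simpa using mem_interior_iff_mem_nhds.1 h
    obtain ⟨ε, hε, hlt⟩ := ((hc.eventually h0).filter_mono nhdsWithin_le_nhds
      |>.and self_mem_nhdsWithin : ∀ᶠ ε in 𝓝[>] (0 : ℝ), _ ∧ ε ∈ Ioi (0 : ℝ)).exists
    exact ⟨ε, hlt, (hD.isReinhardt.mem_logImage_iff _).2 hε⟩
  · rintro ⟨ε, hε, h⟩
    refine hD.mem_interior_of_norm_lt ((hD.isReinhardt.mem_logImage_iff _).1 h) fun j => ?_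
    simp only [Complex.norm_real, Real.norm_of_nonneg (Real.exp_pos _).le]
    exact Real.exp_lt_exp.2 (by linarith)

theorem IsLogConvex.interior_set (hD : IsCompleteReinhardt D) (hc : IsLogConvex D) :
    IsLogConvex (interior D) := by
  intro x hx y hy a b ha hb hab
  rw [hD.mem_logImage_interior_iff] at hx hy ⊢
  obtain ⟨ε, hε, hx⟩ := hx
  obtain ⟨δ, hδ, hy⟩ := hy
  refine ⟨a * ε + b * δ, ?_, ?_⟩
  · rcases ha.eq_or_lt with rfl | ha
    · have : b = 1 := by linarith
      simpa [this] using hδ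
    · positivity
  · convert hc hx hy ha hb hab using 1
    ext j
    simp only [Pi.add_apply, Pi.smul_apply, smul_eq_mul]
    ring

theorem IsCompleteReinhardt.zero_mem (hD : IsCompleteReinhardt D) (hne : D.Nonempty) :
    (0 : Fin n → ℂ) ∈ D :=
  by
  obtain ⟨z, hz⟩ := hne
  exact hD z hz 0 fun j => by simp

theorem IsCompleteReinhardt.isConnected (hD : IsCompleteReinhardt D) (hne : D.Nonempty) :
    IsConnected D := by
  have h : StarConvex ℝ (0 : Fin n → ℂ) D := by
    refine starConvex_zero_iff.2 fun z hz a ha0 ha1 => hD z hz _ fun j => ?_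
    rw [Pi.smul_apply, norm_smul, Real.norm_of_nonneg ha0]
    exact mul_le_of_le_one_left (norm_nonneg _) ha1
  exact (h.isPathConnected (hD.zero_mem hne)).isConnected

theorem IsCompleteReinhardt.isCompleteLogConvexReinhardtDomain_interior
    (hD : IsCompleteReinhardt D) (hc : IsLogConvex D) (hne : (interior D).Nonempty) :
    IsCompleteLogConvexReinhardtDomain (interior D) :=
  ⟨⟨isOpen_interior, hD.interior_set.isConnected hne⟩, hD.interior_set.isReinhardt, hD.interior_set,
    hc.interior_set hD⟩

/-- The smallest complete log-convex Reinhardt domain containing a nonempty open set. -/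
def reinhardtHull (Ω : Set (Fin n → ℂ)) : Set (Fin n → ℂ) :=
  interior (⋂₀ {D | IsCompleteLogConvexReinhardtDomain D ∧ Ω ⊆ D})

/-- Completeness and log-convexity survive arbitrary intersections but openness may not. Taking the
interior restores it, keeps the other two, and still contains the open set `Ω`. -/
theorem isLeast_reinhardtHull {Ω : Set (Fin n → ℂ)} (hΩ : IsOpen Ω) (hne : Ω.Nonempty) :
    IsLeast {D | IsCompleteLogConvexReinhardtDomain D ∧ Ω ⊆ D} (reinhardtHull Ω) := by
  have hsub : Ω ⊆ reinhardtHull Ω := interior_maximal (subset_sInter fun D hD => hD.2) hΩ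
  have hcr : IsCompleteReinhardt (⋂₀ {D | IsCompleteLogConvexReinhardtDomain D ∧ Ω ⊆ D}) :=
    fun z hz w hw D hD => hD.1.2.2.1 z (hz D hD) w hw
  have hlc : IsLogConvex (⋂₀ {D | IsCompleteLogConvexReinhardtDomain D ∧ Ω ⊆ D}) := by
    intro x hx y hy a b ha hb hab
    rw [hcr.isReinhardt.mem_logImage_iff] at hx hy ⊢
    intro D hD
    have hr := hD.1.2.1
    exact (hr.mem_logImage_iff _).1 (hD.1.2.2.2 ((hr.mem_logImage_iff _).2 (hx D hD))
      ((hr.mem_logImage_iff _).2 (hy D hD)) ha hb hab)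
  exact ⟨⟨hcr.isCompleteLogConvexReinhardtDomain_interior hlc (hne.mono hsub), hsub⟩,
    fun D hD => interior_subset.trans (sInter_subset_of_mem hD)⟩

end Geometry

/-! ### Domains of convergence of power series in several variables. -/

section PowerSeries

variable {n : ℕ} (c : (Fin n → ℕ) → ℂ)

/-- The points at which the terms of a multivariate power series are bounded. -/
def boundedTermSet : Set (Fin n → ℂ) :=
  {z | ∃ M : ℝ, ∀ α : Fin n → ℕ, ‖c α‖ * ∏ j, ‖z j‖ ^ α j ≤ M}

theorem isCompleteReinhardt_boundedTermSet : IsCompleteReinhardt (boundedTermSet c) := by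
  rintro z ⟨M, hM⟩ w hw
  refine ⟨M, fun α => le_trans ?_ (hM α)⟩
  gcongr with j
  exact hw j

/-- In logarithmic coordinates a term has modulus `‖c α‖ exp ⟨α, x⟩`, a convex function of `x`, so
bounds `M` and `N` combine to `a * M + b * N`. -/
theorem isLogConvex_boundedTermSet : IsLogConvex (boundedTermSet c) := by
  have key : ∀ (x : Fin n → ℝ) (α : Fin n → ℕ),
      ∏ j, ‖((Real.exp (x j) : ℝ) : ℂ)‖ ^ α j = Real.exp (∑ j, α j * x j) := by
    intro x α
    rw [Real.exp_sum]
    refine Finset.prod_congr rfl fun j _ => ?_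
    rw [Complex.norm_real, Real.norm_of_nonneg (Real.exp_pos _).le, Real.exp_nat_mul]
  intro x hx y hy a b ha hb hab
  rw [(isCompleteReinhardt_boundedTermSet c).isReinhardt.mem_logImage_iff] at hx hy ⊢
  obtain ⟨M, hM⟩ := hx
  obtain ⟨N, hN⟩ := hy
  refine ⟨a * M + b * N, fun α => ?_⟩
  have h1 := hM α
  have h2 := hN α
  rw [key] at h1 h2 ⊢
  have hconv := convexOn_exp.2 (mem_univ (∑ j, α j * x j)) (mem_univ (∑ j, α j * y j)) ha hb hab
  have hsum : ∑ j, (α j : ℝ) * (a • x + b • y) j =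
      a • (∑ j, α j * x j) + b • ∑ j, α j * y j := by
    simp only [Pi.add_apply, Pi.smul_apply, smul_eq_mul, Finset.mul_sum, ← Finset.sum_add_distrib]
    exact Finset.sum_congr rfl fun j _ => by ring
  rw [hsum]
  calc _ ≤ ‖c α‖ * (a • Real.exp (∑ j, α j * x j) + b • Real.exp (∑ j, α j * y j)) := by gcongr
    _ = a * (‖c α‖ * Real.exp (∑ j, α j * x j)) + b * (‖c α‖ * Real.exp (∑ j, α j * y j)) := by
      simp only [smul_eq_mul]; ring
    _ ≤ _ := by gcongr

theorem summable_prod_pow {r : Fin n → ℝ} (h0 : ∀ j, 0 ≤ r j) (h1 : ∀ j, r j < 1) :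
    Summable fun α : Fin n → ℕ => ∏ j, r j ^ α j := by
  classical
  refine summable_of_sum_le (c := ∏ j, (1 - r j)⁻¹)
    (fun α => Finset.prod_nonneg fun j _ => pow_nonneg (h0 j) _) fun s => ?_
  obtain ⟨N, hN⟩ : ∃ N : ℕ, s ⊆ Fintype.piFinset fun _ : Fin n => Finset.range N := by
    refine ⟨(s.sup fun α => ∑ j, α j) + 1, fun α hα => Fintype.mem_piFinset.2 fun j => ?_⟩
    rw [Finset.mem_range, Nat.lt_succ_iff]
    exact (Finset.single_le_sum (fun i _ => Nat.zero_le (α i)) (Finset.mem_univ j)).trans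
      (Finset.le_sup (f := fun α : Fin n → ℕ => ∑ j, α j) hα)
  calc _ ≤ ∑ α ∈ Fintype.piFinset fun _ : Fin n => Finset.range N, ∏ j, r j ^ α j :=
        Finset.sum_le_sum_of_subset_of_nonneg hN fun α _ _ =>
          Finset.prod_nonneg fun j _ => pow_nonneg (h0 j) _
    _ = ∏ j, ∑ k ∈ Finset.range N, r j ^ k := (Finset.prod_univ_sum _ _).symm
    _ ≤ _ := Finset.prod_le_prod
        (fun j _ => Finset.sum_nonneg fun k _ => pow_nonneg (h0 j) _) fun j _ => by
          rw [← tsum_geometric_of_lt_one (h0 j) (h1 j)]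
          exact (summable_geometric_of_lt_one (h0 j) (h1 j)).sum_le_tsum _
            fun k _ => pow_nonneg (h0 j) _

/-- Abel's lemma: locally uniform summable bounds inside the set of bounded terms. -/
theorem exists_summable_bound_of_mem_interior {z : Fin n → ℂ}
    (hz : z ∈ interior (boundedTermSet c)) :
    ∃ U : Set (Fin n → ℂ), IsOpen U ∧ z ∈ U ∧ ∃ u : (Fin n → ℕ) → ℝ, Summable u ∧
      ∀ α, ∀ w ∈ U, ‖c α * ∏ j, w j ^ α j‖ ≤ u α := by
  obtain ⟨ε, hε, y, ⟨M, hM⟩, hyz⟩ := exists_mem_norm_eq_norm_add (mem_interior_iff_mem_nhds.1 hz)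
  have hy0 : ∀ j, 0 < ‖y j‖ := fun j => by rw [hyz]; positivity
  have hr0 : ∀ j, 0 ≤ (‖z j‖ + ε / 2) / ‖y j‖ := fun j => by positivity
  -- This polydisc lies strictly between `z` and `y`, where the terms are bounded and `‖y j‖ = ‖z j‖
  -- + ε`; the ratios below 1 give a geometric majorant.
  refine ⟨{w | ∀ j, ‖w j‖ < ‖z j‖ + ε / 2}, ?_, fun j => by linarith,
    fun α => M * ∏ j, ((‖z j‖ + ε / 2) / ‖y j‖) ^ α j, ?_, fun α w hw => ?_⟩
  · simp only [ofPred_forall]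
    exact isOpen_iInter_of_finite fun j =>
      isOpen_lt ((continuous_apply j).norm) continuous_const
  · refine (summable_prod_pow hr0 fun j => ?_).mul_left M
    rw [div_lt_one (hy0 j), hyz]
    linarith
  · have hpos : 0 < ∏ j, ‖y j‖ ^ α j := Finset.prod_pos fun j _ => pow_pos (hy0 j) _
    simp only [div_pow, Finset.prod_div_distrib, norm_mul, norm_prod, norm_pow]
    have hle : ‖c α‖ ≤ M / ∏ j, ‖y j‖ ^ α j := (le_div_iff₀ hpos).2 (hM α)
    calc _ ≤ M / (∏ j, ‖y j‖ ^ α j) * ∏ j, (‖z j‖ + ε / 2) ^ α j := by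
          gcongr with j
          · exact le_trans (norm_nonneg _) hle
          · exact (hw j).le
      _ = _ := by ring

theorem summable_of_mem_interior_boundedTermSet {z : Fin n → ℂ}
    (hz : z ∈ interior (boundedTermSet c)) : Summable fun α => c α * ∏ j, z j ^ α j := by
  obtain ⟨U, -, hzU, u, hu, hb⟩ := exists_summable_bound_of_mem_interior c hz
  exact Summable.of_norm_bounded hu fun α => hb α z hzU

theorem differentiableOn_tsum_monomial :
    DifferentiableOn ℂ (fun z : Fin n → ℂ => ∑' α, c α * ∏ j, z j ^ α j)
      (interior (boundedTermSet c)) := by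
  intro z hz
  obtain ⟨U, hU, hzU, u, hu, hb⟩ := exists_summable_bound_of_mem_interior c hz
  exact ((differentiableOn_tsum_of_summable_norm_le hu hU
    (fun α => Differentiable.differentiableOn (by fun_prop)) hb).differentiableAt
    (hU.mem_nhds hzU)).differentiableWithinAt

end PowerSeries

/-! ### Connectedness of the complement of the coordinate hyperplanes. -/

section Connected

theorem isPreconnected_ball_zero_diff_zero (r : ℝ) :
    IsPreconnected (ball (0 : ℂ) r \ {0}) := by
  have h : ball (0 : ℂ) r \ {0} =
      (fun p : ℝ × ℝ => (p.1 : ℂ) * Complex.exp (p.2 * Complex.I)) '' (Ioo 0 r ×ˢ univ) := by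
    ext z
    constructor
    · rintro ⟨hz, hz0⟩
      refine ⟨(‖z‖, z.arg), ⟨⟨norm_pos_iff.2 hz0, by simpa using hz⟩, mem_univ _⟩, ?_⟩
      exact Complex.norm_mul_exp_arg_mul_I z
    · rintro ⟨⟨ρ, θ⟩, ⟨⟨h1, h2⟩, -⟩, rfl⟩
      simp only at h1 h2
      refine ⟨?_, ?_⟩
      · simpa [Complex.norm_exp_ofReal_mul_I, abs_of_pos h1] using h2
      · simp [h1.ne']
  rw [h]
  exact ((isPreconnected_Ioo.prod isPreconnected_univ)).image _ (by fun_prop)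

theorem exists_isPreconnected_ball_diff_zero (a : ℂ) {δ : ℝ} (hδ : 0 < δ) :
    ∃ r₀ > 0, r₀ ≤ δ ∧ ∀ r, r ≤ r₀ → IsPreconnected (ball a r \ {0}) := by
  rcases eq_or_ne a 0 with rfl | ha
  · exact ⟨δ, hδ, le_rfl, fun r _ => isPreconnected_ball_zero_diff_zero r⟩
  · refine ⟨min δ ‖a‖, lt_min hδ (norm_pos_iff.2 ha), min_le_left _ _, fun r hr => ?_⟩
    rw [sdiff_singleton_eq_self]
    · exact (convex_ball a r).isPreconnected
    · rw [mem_ball, dist_comm, dist_zero_right, not_lt]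
      exact hr.trans (min_le_right _ _)

variable {n : ℕ}

theorem dense_forall_ne_zero : Dense {z : Fin n → ℂ | ∀ j, z j ≠ 0} := by
  intro z
  rw [mem_closure_iff_nhds]
  intro U hU
  obtain ⟨ε, hε, w, hw, hwz⟩ := exists_mem_norm_eq_norm_add hU
  exact ⟨w, hw, fun j => norm_pos_iff.1 (by rw [hwz]; positivity)⟩

theorem isOpen_forall_ne_zero : IsOpen {z : Fin n → ℂ | ∀ j, z j ≠ 0} := by
  simp only [ofPred_forall]
  exact isOpen_iInter_of_finite fun j => isOpen_ne.preimage (continuous_apply j)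

/-- A connected open set remains connected after removing the coordinate hyperplanes. -/
theorem IsPreconnected.inter_forall_ne_zero {Ω : Set (Fin n → ℂ)} (hΩ : IsOpen Ω)
    (hc : IsPreconnected Ω) : IsPreconnected (Ω ∩ {z | ∀ j, z j ≠ 0}) := by
  set S : Set (Fin n → ℂ) := {z | ∀ j, z j ≠ 0} with hS
  refine isPreconnected_of_forall_constant fun g hg x hx y hy => ?_
  -- `A b` collects the points, on the hyperplanes too, near which `g` takes only the value `b` off
  -- the hyperplanes. The sets `A true` and `A false` are open, disjoint on `Ω` by density, and
  -- cover it since small polydiscs minus the hyperplanes are connected.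
  set A : Bool → Set (Fin n → ℂ) := fun b => {p | ∀ᶠ z in 𝓝[S] p, g z = b} with hA
  have hAo : ∀ b, IsOpen (A b) := fun b =>
    isOpen_iff_mem_nhds.2 fun p hp =>
      (eventually_nhds_nhdsWithin.2 hp : ∀ᶠ q in 𝓝 p, ∀ᶠ z in 𝓝[S] q, g z = b)
  have hne : ∀ p, (𝓝[S] p).NeBot := fun p => mem_closure_iff_nhdsWithin_neBot.1
    (dense_forall_ne_zero p)
  have hcov : Ω ⊆ A true ∪ A false := by
    intro p hp
    obtain ⟨δ, hδ, hball⟩ := Metric.isOpen_iff.1 hΩ p hp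
    choose r hr0 hrδ hr using fun j => exists_isPreconnected_ball_diff_zero (p j) hδ
    obtain ⟨ρ, hρ0, hρδ, hρ⟩ : ∃ ρ > 0, ρ ≤ δ ∧ ∀ j, ρ ≤ r j := by
      obtain ⟨ρ, hρ, h⟩ := (((eventually_all.2 fun j => Iic_mem_nhds (hr0 j)).and
        (Iic_mem_nhds hδ)).filter_mono nhdsWithin_le_nhds |>.and self_mem_nhdsWithin :
        ∀ᶠ ρ in 𝓝[>] (0 : ℝ), ((∀ j, ρ ≤ r j) ∧ ρ ≤ δ) ∧ ρ ∈ Ioi (0 : ℝ)).exists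
      exact ⟨ρ, h, hρ.2, hρ.1⟩
    have heq : ball p ρ ∩ S = univ.pi fun j => ball (p j) ρ \ {0} := by
      rw [ball_pi p hρ0]
      ext z
      simp only [hS, mem_inter_iff, mem_univ_pi, Set.mem_sdiff, mem_singleton_iff, mem_ofPred_eq]
      exact forall_and.symm
    have hpre : IsPreconnected (ball p ρ ∩ S) := by
      rw [heq]
      exact isPreconnected_univ_pi fun j => hr j ρ (hρ j)
    have hsub : ball p ρ ∩ S ⊆ Ω ∩ S :=
      inter_subset_inter_left _ ((ball_subset_ball hρδ).trans hball)
    have hmem : ball p ρ ∩ S ∈ 𝓝[S] p :=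
      inter_mem (mem_nhdsWithin_of_mem_nhds (ball_mem_nhds p hρ0)) self_mem_nhdsWithin
    obtain ⟨w, hw⟩ := (hne p).nonempty_of_mem hmem
    have hconst : ∀ᶠ z in 𝓝[S] p, g z = g w := by
      filter_upwards [hmem] with z hz using hpre.constant (hg.mono hsub) hz hw
    cases hgw : g w
    · exact Or.inr (by simpa [hA, hgw] using hconst)
    · exact Or.inl (by simpa [hA, hgw] using hconst)
  have hdisj : Ω ∩ (A true ∩ A false) = ∅ := by
    refine eq_empty_of_forall_notMem fun p hp => ?_
    have := hne p
    have ht : ∀ᶠ z in 𝓝[S] p, g z = true := hp.2.1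
    have hf : ∀ᶠ z in 𝓝[S] p, g z = false := hp.2.2
    obtain ⟨z, h1, h2⟩ := (ht.and hf).exists
    simp [h1] at h2
  obtain ⟨b, hb⟩ : ∃ b, Ω ⊆ A b := by
    rcases isPreconnected_iff_subset_of_disjoint.1 hc _ _ (hAo true) (hAo false) hcov hdisj
      with h | h
    exacts [⟨_, h⟩, ⟨_, h⟩]
  have hval : ∀ p ∈ Ω ∩ S, g p = b := fun p hp => (hb hp.1).self_of_nhdsWithin hp.2
  rw [hval x hx, hval y hy]

end Connected

/-! ### Laurent coefficients via the torus action. -/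

section Torus

open UnitAddTorus

variable {n : ℕ}

/-- The action of the torus on `ℂⁿ` by rotation of the coordinates. -/
noncomputable def torusMul (t : UnitAddTorus (Fin n)) : (Fin n → ℂ) →L[ℂ] (Fin n → ℂ) :=
  ContinuousLinearMap.pi fun j => (fourier 1 (t j) : ℂ) • ContinuousLinearMap.proj j

/-- Laurent monomials. -/
noncomputable def laurentMonomial (α : Fin n → ℤ) (z : Fin n → ℂ) : ℂ := ∏ j, z j ^ α j

/-- The normalized Haar measure on the torus. -/
noncomputable abbrev torusHaar (n : ℕ) : Measure (UnitAddTorus (Fin n)) :=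
  Measure.pi fun _ => AddCircle.haarAddCircle

/-- The component of weight `α` of `f` under the torus action. -/
noncomputable def laurentTerm (f : (Fin n → ℂ) → ℂ) (α : Fin n → ℤ) (z : Fin n → ℂ) : ℂ :=
  mFourierCoeff (fun t => f (torusMul t z)) α

/-- The Laurent coefficient of `f` computed on the torus through `z`. -/
noncomputable def laurentCoeff (f : (Fin n → ℂ) → ℂ) (z : Fin n → ℂ) (α : Fin n → ℤ) : ℂ :=
  laurentTerm f α z * laurentMonomial (-α) z

theorem torusMul_apply (t : UnitAddTorus (Fin n)) (z : Fin n → ℂ) (j : Fin n) :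
    torusMul t z j = fourier 1 (t j) * z j := rfl

theorem norm_fourier_apply (k : ℤ) (x : UnitAddCircle) : ‖(fourier k x : ℂ)‖ = 1 := by
  rw [fourier_apply]; exact Circle.norm_coe _

theorem norm_torusMul_apply (t : UnitAddTorus (Fin n)) (z : Fin n → ℂ) (j : Fin n) :
    ‖torusMul t z j‖ = ‖z j‖ := by
  rw [torusMul_apply, norm_mul, norm_fourier_apply, one_mul]

theorem norm_torusMul (t : UnitAddTorus (Fin n)) (z : Fin n → ℂ) : ‖torusMul t z‖ = ‖z‖ := by
  simp only [Pi.norm_def, nnnorm, norm_torusMul_apply]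

theorem continuous_torusMul :
    Continuous fun p : (Fin n → ℂ) × UnitAddTorus (Fin n) => torusMul p.2 p.1 := by
  refine continuous_pi fun j => ?_
  simp only [torusMul_apply]
  fun_prop

theorem laurentTerm_eq_integral (f : (Fin n → ℂ) → ℂ) (α : Fin n → ℤ) :
    laurentTerm f α = fun z => ∫ t, mFourier (-α) t • f (torusMul t z) ∂torusHaar n := rfl

theorem torusMul_zero (z : Fin n → ℂ) : torusMul 0 z = z := by
  ext j
  simp [torusMul_apply]

theorem torusMul_torusMul (s t : UnitAddTorus (Fin n)) (z : Fin n → ℂ) :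
    torusMul t (torusMul s z) = torusMul (t + s) z := by
  ext j
  simp only [torusMul_apply, Pi.add_apply, fourier_apply, smul_add, AddCircle.toCircle_add,
    Circle.coe_mul]
  ring

theorem torusMul_single (t : UnitAddTorus (Fin n)) (j : Fin n) :
    torusMul t (Pi.single j 1) = (fourier 1 (t j) : ℂ) • Pi.single j (1 : ℂ) := by
  ext k
  rcases eq_or_ne k j with rfl | h
  · simp [torusMul_apply]
  · simp [torusMul_apply, h]

theorem IsReinhardt.torusMul_mem {Ω : Set (Fin n → ℂ)} (hR : IsReinhardt Ω) {z : Fin n → ℂ}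
    (hz : z ∈ Ω) (t : UnitAddTorus (Fin n)) : torusMul t z ∈ Ω :=
  hR z hz _ (norm_torusMul_apply t z)

theorem mFourier_add_apply (α : Fin n → ℤ) (s t : UnitAddTorus (Fin n)) :
    mFourier α (s + t) = mFourier α s * mFourier α t := by
  simp [mFourier, fourier_apply, AddCircle.toCircle_add, smul_add, Finset.prod_mul_distrib]

theorem norm_mFourier_apply (α : Fin n → ℤ) (t : UnitAddTorus (Fin n)) :
    ‖mFourier α t‖ = 1 := by
  simp only [mFourier, ContinuousMap.coe_mk, norm_prod, norm_fourier_apply, Finset.prod_const_one]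

theorem mFourier_neg_mul_self (α : Fin n → ℤ) (t : UnitAddTorus (Fin n)) :
    mFourier (-α) t * mFourier α t = 1 := by
  rw [← mFourier_add, neg_add_cancel, mFourier_zero, ContinuousMap.one_apply]

theorem laurentMonomial_torusMul (α : Fin n → ℤ) (t : UnitAddTorus (Fin n)) (z : Fin n → ℂ) :
    laurentMonomial α (torusMul t z) = mFourier α t * laurentMonomial α z := by
  simp only [laurentMonomial, torusMul_apply, mul_zpow, Finset.prod_mul_distrib, mFourier,
    ContinuousMap.coe_mk]
  congr 1
  refine Finset.prod_congr rfl fun j _ => ?_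
  rw [fourier_apply, fourier_apply, one_smul, AddCircle.toCircle_zsmul, Circle.coe_zpow]

theorem laurentMonomial_neg_mul_self (α : Fin n → ℤ) {z : Fin n → ℂ} (hz : ∀ j, z j ≠ 0) :
    laurentMonomial (-α) z * laurentMonomial α z = 1 := by
  rw [laurentMonomial, laurentMonomial, ← Finset.prod_mul_distrib]
  refine Finset.prod_eq_one fun j _ => ?_
  rw [Pi.neg_apply, zpow_neg, inv_mul_cancel₀ (zpow_ne_zero _ (hz j))]

theorem laurentCoeff_mul_laurentMonomial (f : (Fin n → ℂ) → ℂ) (α : Fin n → ℤ) {z : Fin n → ℂ}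
    (hz : ∀ j, z j ≠ 0) : laurentCoeff f z α * laurentMonomial α z = laurentTerm f α z := by
  rw [laurentCoeff, mul_assoc, laurentMonomial_neg_mul_self α hz, mul_one]

/-- Substitute `t ↦ t + s`, using invariance of Haar measure. -/
theorem laurentTerm_torusMul (f : (Fin n → ℂ) → ℂ) (α : Fin n → ℤ) (s : UnitAddTorus (Fin n))
    (z : Fin n → ℂ) : laurentTerm f α (torusMul s z) = mFourier α s * laurentTerm f α z := by
  have h := integral_add_right_eq_self (μ := torusHaar n)
    (fun t : UnitAddTorus (Fin n) => mFourier α s * (mFourier (-α) t * f (torusMul t z))) s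
  simp only [laurentTerm_eq_integral, smul_eq_mul]
  rw [← integral_const_mul, ← h]
  refine integral_congr_ae (Eventually.of_forall fun t => ?_)
  simp only [torusMul_torusMul]
  rw [mFourier_add_apply]
  linear_combination (-(mFourier (-α) t * f (torusMul (t + s) z))) * mFourier_neg_mul_self α s

theorem laurentCoeff_torusMul (f : (Fin n → ℂ) → ℂ) (α : Fin n → ℤ) (s : UnitAddTorus (Fin n))
    (z : Fin n → ℂ) : laurentCoeff f (torusMul s z) α = laurentCoeff f z α := by
  rw [laurentCoeff, laurentCoeff, laurentTerm_torusMul, laurentMonomial_torusMul]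
  linear_combination (laurentTerm f α z * laurentMonomial (-α) z) * mFourier_neg_mul_self α s

theorem norm_laurentTerm_le {f : (Fin n → ℂ) → ℂ} {z : Fin n → ℂ} {M : ℝ}
    (hM : ∀ t, ‖f (torusMul t z)‖ ≤ M) (α : Fin n → ℤ) : ‖laurentTerm f α z‖ ≤ M := by
  simp only [laurentTerm_eq_integral]
  refine (norm_integral_le_of_norm_le_const (C := M) (Eventually.of_forall fun t => ?_)).trans ?_
  · rw [norm_smul, norm_mFourier_apply, one_mul]
    exact hM t
  · simp

section Holomorphic

variable {Ω : Set (Fin n → ℂ)} {f : (Fin n → ℂ) → ℂ}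

theorem continuousOn_laurentIntegrand (hR : IsReinhardt Ω) (hf : ContinuousOn f Ω)
    (α : Fin n → ℤ) :
    ContinuousOn (Function.uncurry fun (z : Fin n → ℂ) t => mFourier (-α) t • f (torusMul t z))
      (Ω ×ˢ univ) :=
  ((mFourier (-α)).continuous.comp continuous_snd).continuousOn.smul
    (hf.comp continuous_torusMul.continuousOn fun p hp => hR.torusMul_mem hp.1 p.2)

theorem differentiableOn_laurentIntegrand (hR : IsReinhardt Ω) (hf : DifferentiableOn ℂ f Ω)
    (α : Fin n → ℤ) (t : UnitAddTorus (Fin n)) :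
    DifferentiableOn ℂ (fun z => mFourier (-α) t • f (torusMul t z)) Ω := by
  have h : DifferentiableOn ℂ (fun z => f (torusMul t z)) Ω :=
    hf.comp (torusMul t).differentiable.differentiableOn fun z hz => hR.torusMul_mem hz t
  exact h.const_smul (mFourier (-α) t)

theorem differentiableOn_laurentTerm (hΩ : IsOpen Ω) (hR : IsReinhardt Ω)
    (hf : DifferentiableOn ℂ f Ω) (α : Fin n → ℤ) : DifferentiableOn ℂ (laurentTerm f α) Ω := by
  intro z hz
  have := hasFDerivAt_setIntegral_of_param (μ := torusHaar n)
    isCompact_univ .univ hΩ (continuousOn_laurentIntegrand hR hf.continuousOn α)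
    (fun t _ => differentiableOn_laurentIntegrand hR hf α t) hz
  simp only [Measure.restrict_univ, ← laurentTerm_eq_integral] at this
  exact this.differentiableAt.differentiableWithinAt

/-- Partial derivatives shift the weight of the components. -/
theorem fderiv_laurentTerm (hΩ : IsOpen Ω) (hR : IsReinhardt Ω)
    (hf : DifferentiableOn ℂ f Ω) (α : Fin n → ℤ) {z : Fin n → ℂ} (hz : z ∈ Ω) (j : Fin n) :
    fderiv ℂ (laurentTerm f α) z (Pi.single j 1) =
      laurentTerm (fun w => fderiv ℂ f w (Pi.single j 1)) (α - Pi.single j 1) z := by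
  have h := fderiv_setIntegral_of_param_apply (μ := torusHaar n)
    isCompact_univ .univ hΩ (continuousOn_laurentIntegrand hR hf.continuousOn α)
    (fun t _ => differentiableOn_laurentIntegrand hR hf α t) hz (Pi.single j 1)
  simp only [Measure.restrict_univ, ← laurentTerm_eq_integral] at h
  refine h.trans (integral_congr_ae (Eventually.of_forall fun t => ?_))
  have h1 := (hf.differentiableAt (hΩ.mem_nhds (hR.torusMul_mem hz t))).hasFDerivAt
  have h2 : HasFDerivAt (fun z => mFourier (-α) t • f (torusMul t z)) _ z :=
    (h1.comp z (torusMul t).hasFDerivAt).const_smul (mFourier (-α) t)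
  simp only
  -- Rotating `e_j` by `t` multiplies it by the character of weight `e_j`, which shifts the weight
  -- of the component.
  rw [h2.fderiv, show -(α - Pi.single j 1) = -α + Pi.single j 1 by abel, mFourier_add,
    mFourier_single]
  simp [torusMul_single, mul_assoc]

theorem differentiableAt_laurentMonomial (α : Fin n → ℤ) {z : Fin n → ℂ} (hz : ∀ j, z j ≠ 0) :
    DifferentiableAt ℂ (laurentMonomial α) z := by
  classical
  have h : ∀ j, DifferentiableAt ℂ (fun w : Fin n → ℂ => w j ^ α j) z := fun j =>
    DifferentiableAt.comp (g := fun s : ℂ => s ^ α j) (f := fun w : Fin n → ℂ => w j) z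
      (differentiableAt_zpow.2 (Or.inl (hz j))) (hasFDerivAt_apply j z).differentiableAt
  exact (HasFDerivAt.finsetProd fun j _ => (h j).hasFDerivAt).differentiableAt

theorem fderiv_laurentMonomial (α : Fin n → ℤ) {z : Fin n → ℂ} (hz : ∀ j, z j ≠ 0) (j : Fin n) :
    fderiv ℂ (laurentMonomial α) z (Pi.single j 1) =
      α j * laurentMonomial (α - Pi.single j 1) z := by
  classical
  have h1 : HasDerivAt (fun s : ℂ => laurentMonomial α (Function.update z j s))
      (fderiv ℂ (laurentMonomial α) z (Pi.single j 1)) (z j) := by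
    have h := (differentiableAt_laurentMonomial α hz).hasFDerivAt
    rw [← Function.update_eq_self j z] at h
    simpa [Function.comp_def] using h.comp_hasDerivAt (z j) (hasDerivAt_update z j (z j))
  have h2 : HasDerivAt (fun s : ℂ => s ^ α j * ∏ k ∈ Finset.univ.erase j, z k ^ α k)
      (α j * z j ^ (α j - 1) * ∏ k ∈ Finset.univ.erase j, z k ^ α k) (z j) :=
    (hasDerivAt_zpow (α j) (z j) (Or.inl (hz j))).mul_const _
  have h3 : (fun s : ℂ => laurentMonomial α (Function.update z j s)) =
      fun s : ℂ => s ^ α j * ∏ k ∈ Finset.univ.erase j, z k ^ α k := by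
    ext s
    rw [laurentMonomial, ← Finset.mul_prod_erase _ _ (Finset.mem_univ j), Function.update_self]
    congr 1
    exact Finset.prod_congr rfl fun k hk => by
      rw [Function.update_of_ne (Finset.ne_of_mem_erase hk)]
  rw [h3] at h1
  rw [h1.unique h2, laurentMonomial, ← Finset.mul_prod_erase _ _ (Finset.mem_univ j), mul_assoc]
  congr 2
  · simp
  · exact Finset.prod_congr rfl fun k hk => by
      simp [Pi.single_eq_of_ne (Finset.ne_of_mem_erase hk)]

/-- The Laurent coefficients of a holomorphic function do not depend on the torus on which they
are computed. -/
theorem laurentCoeff_eq (hΩ : IsOpen Ω) (hc : IsPreconnected Ω) (hR : IsReinhardt Ω)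
    (hf : DifferentiableOn ℂ f Ω) (α : Fin n → ℤ) {z w : Fin n → ℂ} (hz : z ∈ Ω)
    (hz0 : ∀ j, z j ≠ 0) (hw : w ∈ Ω) (hw0 : ∀ j, w j ≠ 0) :
    laurentCoeff f z α = laurentCoeff f w α := by
  have hd : ∀ x ∈ Ω, (∀ j, x j ≠ 0) → DifferentiableAt ℂ (fun y => laurentCoeff f y α) x :=
    fun x hx hx0 => ((differentiableOn_laurentTerm hΩ hR hf α).differentiableAt
      (hΩ.mem_nhds hx)).mul (differentiableAt_laurentMonomial (-α) hx0)
  refine (hΩ.inter isOpen_forall_ne_zero).is_const_of_fderiv_eq_zero (𝕜 := ℂ)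
    (f := fun y => laurentCoeff f y α) (hc.inter_forall_ne_zero hΩ)
    (fun x hx => (hd x hx.1 hx.2).differentiableWithinAt) (fun x hx => ?_) ⟨hz, hz0⟩ ⟨hw, hw0⟩
  have hD := (hd x hx.1 hx.2).hasFDerivAt
  set L := fderiv ℂ (fun y => laurentCoeff f y α) x with hL
  -- The coefficient is constant along rotations of coordinate `j`, whose velocity at `x` is `i x_j
  -- e_j`. Complex linearity and `x j ≠ 0` then kill the derivative along `e_j`.
  have hdir : ∀ j, L (Pi.single j 1) = 0 := by
    intro j
    have hγ : HasDerivAt (fun θ : ℝ => Function.update x j (Complex.exp (θ * Complex.I) * x j))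
        ((Complex.I * x j) • Pi.single j (1 : ℂ)) 0 := by
      have h1 : HasDerivAt (fun θ : ℝ => Complex.exp (θ * Complex.I) * x j) (Complex.I * x j) 0 := by
        have h2 : HasDerivAt (fun θ : ℝ => (θ : ℂ) * Complex.I) Complex.I 0 := by
          simpa using (Complex.ofRealCLM.hasDerivAt (x := (0 : ℝ))).mul_const Complex.I
        simpa using (h2.cexp).mul_const (x j)
      exact (hasDerivAt_update x j _).scomp (0 : ℝ) h1
    have hcomp : HasDerivAt (fun θ : ℝ => laurentCoeff f
        (Function.update x j (Complex.exp (θ * Complex.I) * x j)) α)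
        (L ((Complex.I * x j) • Pi.single j (1 : ℂ))) 0 := by
      have hD' : HasFDerivAt (fun y => laurentCoeff f y α) (L.restrictScalars ℝ)
          (Function.update x j (Complex.exp ((0 : ℝ) * Complex.I) * x j)) := by
        simpa using hD.restrictScalars ℝ
      exact hD'.comp_hasDerivAt (0 : ℝ) hγ
    have hconst : (fun θ : ℝ => laurentCoeff f
        (Function.update x j (Complex.exp (θ * Complex.I) * x j)) α) =
        fun _ => laurentCoeff f x α := by
      ext θ
      rw [← laurentCoeff_torusMul f α (Pi.single j ((θ / (2 * Real.pi) : ℝ) : UnitAddCircle)) x]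
      congr 1
      ext k
      rcases eq_or_ne k j with rfl | hk
      · rw [Function.update_self, torusMul_apply, Pi.single_eq_same, fourier_coe_apply]
        congr 2
        push_cast
        field_simp
      · rw [Function.update_of_ne hk, torusMul_apply, Pi.single_eq_of_ne hk, fourier_eval_zero,
          one_mul]
    rw [hconst] at hcomp
    have h0 := hcomp.unique (hasDerivAt_const (0 : ℝ) (laurentCoeff f x α))
    rw [map_smul, smul_eq_mul] at h0
    exact (mul_eq_zero.1 h0).resolve_left (mul_ne_zero Complex.I_ne_zero (hx.2 j))
  refine ContinuousLinearMap.ext fun v => ?_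
  rw [show v = ∑ j, v j • Pi.single j (1 : ℂ) from pi_eq_sum_univ' v, map_sum]
  simp [hdir]

theorem laurentTerm_eq_laurentCoeff_mul (hΩ : IsOpen Ω) (hc : IsPreconnected Ω)
    (hR : IsReinhardt Ω) (hf : DifferentiableOn ℂ f Ω) (α : Fin n → ℤ) {z w : Fin n → ℂ}
    (hz : z ∈ Ω) (hz0 : ∀ j, z j ≠ 0) (hw : w ∈ Ω) (hw0 : ∀ j, w j ≠ 0) :
    laurentTerm f α w = laurentCoeff f z α * laurentMonomial α w := by
  rw [laurentCoeff_eq hΩ hc hR hf α hz hz0 hw hw0, laurentCoeff_mul_laurentMonomial f α hw0]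

/-- Differentiation acts on Laurent coefficients as on formal Laurent series. -/
theorem laurentCoeff_fderiv (hΩ : IsOpen Ω) (hc : IsPreconnected Ω) (hR : IsReinhardt Ω)
    (hf : DifferentiableOn ℂ f Ω) (α : Fin n → ℤ) {z : Fin n → ℂ} (hz : z ∈ Ω)
    (hz0 : ∀ j, z j ≠ 0) (j : Fin n) :
    laurentCoeff (fun w => fderiv ℂ f w (Pi.single j 1)) z (α - Pi.single j 1) =
      α j * laurentCoeff f z α := by
  have h1 : laurentTerm f α =ᶠ[𝓝 z] fun w => laurentCoeff f z α * laurentMonomial α w := by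
    filter_upwards [hΩ.mem_nhds hz, isOpen_forall_ne_zero.mem_nhds hz0] with w hw hw0 using
      laurentTerm_eq_laurentCoeff_mul hΩ hc hR hf α hz hz0 hw hw0
  have h2 := fderiv_laurentTerm hΩ hR hf α hz j
  rw [h1.fderiv_eq, fderiv_const_mul (differentiableAt_laurentMonomial α hz0),
    _root_.smul_apply, fderiv_laurentMonomial α hz0, smul_eq_mul] at h2
  rw [laurentCoeff, ← h2]
  linear_combination (laurentCoeff f z α * α j) *
    laurentMonomial_neg_mul_self (α - Pi.single j 1) hz0

end Holomorphic

end Torus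

/-! ### Iterated derivatives and Taylor coefficients. -/

section IterDirDeriv

variable {n : ℕ} {Ω : Set (Fin n → ℂ)} {f g : (Fin n → ℂ) → ℂ}

theorem iterDirDeriv_cons (𝕜 : Type*) [NontriviallyNormedField 𝕜] {E F : Type*}
    [NormedAddCommGroup E] [NormedSpace 𝕜 E] [NormedAddCommGroup F] [NormedSpace 𝕜 F]
    (v : E) (L : List E) (f : E → F) :
    iterDirDeriv 𝕜 (v :: L) f = fun z => fderiv 𝕜 (iterDirDeriv 𝕜 L f) z v := rfl

theorem iterDirDeriv_concat (𝕜 : Type*) [NontriviallyNormedField 𝕜] {E F : Type*}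
    [NormedAddCommGroup E] [NormedSpace 𝕜 E] [NormedAddCommGroup F] [NormedSpace 𝕜 F]
    (L : List E) (v : E) (f : E → F) :
    iterDirDeriv 𝕜 (L ++ [v]) f = iterDirDeriv 𝕜 L (fun z => fderiv 𝕜 f z v) := by
  simp [iterDirDeriv]

theorem differentiableOn_iterDirDeriv (hΩ : IsOpen Ω) (hf : DifferentiableOn ℂ f Ω)
    (L : List (Fin n → ℂ)) : DifferentiableOn ℂ (iterDirDeriv ℂ L f) Ω := by
  induction L with
  | nil => exact hf
  | cons v L ih => exact differentiableOn_fderiv_apply hΩ ih v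

theorem eqOn_iterDirDeriv (hΩ : IsOpen Ω) (h : EqOn f g Ω) (L : List (Fin n → ℂ)) :
    EqOn (iterDirDeriv ℂ L f) (iterDirDeriv ℂ L g) Ω := by
  induction L with
  | nil => exact h
  | cons v L ih =>
    intro z hz
    rw [iterDirDeriv_cons, iterDirDeriv_cons]
    simp only [(ih.eventuallyEq_of_mem (hΩ.mem_nhds hz)).fderiv_eq]

theorem eqOn_iterDirDeriv_real_complex (hΩ : IsOpen Ω) (hf : DifferentiableOn ℂ f Ω)
    (L : List (Fin n → ℂ)) : EqOn (iterDirDeriv ℝ L f) (iterDirDeriv ℂ L f) Ω := by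
  induction L with
  | nil => exact fun z _ => rfl
  | cons v L ih =>
    intro z hz
    rw [iterDirDeriv_cons, iterDirDeriv_cons]
    simp only [(ih.eventuallyEq_of_mem (hΩ.mem_nhds hz)).fderiv_eq]
    rw [((differentiableOn_iterDirDeriv hΩ hf L).differentiableAt
      (hΩ.mem_nhds hz)).fderiv_restrictScalars ℝ]
    rfl

/-- Iterated complex partial derivatives along a list of coordinates. -/
noncomputable def listPartial (J : List (Fin n)) (f : (Fin n → ℂ) → ℂ) : (Fin n → ℂ) → ℂ :=
  iterDirDeriv ℂ (J.map fun j => Pi.single j 1) f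

theorem complexPartial_eq_listPartial (α : Fin n → ℕ) (f : (Fin n → ℂ) → ℂ) :
    complexPartial α f =
      listPartial ((List.finRange n).flatMap fun j => List.replicate (α j) j) f := by
  rw [complexPartial, listPartial, List.map_flatMap]
  simp only [List.map_replicate]

theorem count_flatMap_replicate (α : Fin n → ℕ) (k : Fin n) :
    ((List.finRange n).flatMap fun j => List.replicate (α j) j).count k = α k := by
  rw [List.count_flatMap, ← List.ofFn_eq_map, List.sum_ofFn]
  simp [List.count_replicate]

variable {z : Fin n → ℂ}

/-- Iterates `laurentCoeff_fderiv`. Factorials on both sides avoid quotients, and `α` varies in the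
induction because the outermost derivative refers to the coefficient at `α + e_j`. -/
theorem prod_factorial_mul_laurentCoeff_listPartial (hΩ : IsOpen Ω) (hc : IsPreconnected Ω)
    (hR : IsReinhardt Ω) (hf : DifferentiableOn ℂ f Ω) (hz : z ∈ Ω) (hz0 : ∀ j, z j ≠ 0)
    (J : List (Fin n)) (α : Fin n → ℕ) :
    (∏ k, ((α k).factorial : ℂ)) * laurentCoeff (listPartial J f) z (fun k => α k) =
      (∏ k, ((α k + J.count k).factorial : ℂ)) *
        laurentCoeff f z (fun k => (α k + J.count k : ℕ)) := by
  classical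
  induction J generalizing α with
  | nil => simp [listPartial, iterDirDeriv]
  | cons j J ih =>
    have hJ : DifferentiableOn ℂ (listPartial J f) Ω := differentiableOn_iterDirDeriv hΩ hf _
    have h1 := laurentCoeff_fderiv hΩ hc hR hJ
      (fun k => ((α + Pi.single j 1 : Fin n → ℕ) k : ℤ)) hz hz0 j
    have h2 := ih (α + Pi.single j 1)
    have e1 : ((fun k => ((α + Pi.single j 1 : Fin n → ℕ) k : ℤ)) - Pi.single j 1 : Fin n → ℤ) =
        fun k => (α k : ℤ) := by
      ext k
      rcases eq_or_ne k j with rfl | hk <;> simp [*]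
    have e2 : ∀ k, (α + Pi.single j 1 : Fin n → ℕ) k + J.count k = α k + (j :: J).count k := by
      intro k
      rcases eq_or_ne k j with rfl | hk
      · simp; ring
      · simp [hk, List.count_cons_of_ne hk.symm]
    have e3 : (∏ k, (((α + Pi.single j 1 : Fin n → ℕ) k).factorial : ℂ)) =
        (α j + 1) * ∏ k, ((α k).factorial : ℂ) := by
      rw [← Finset.mul_prod_erase _ _ (Finset.mem_univ j),
        ← Finset.mul_prod_erase _ (fun k => ((α k).factorial : ℂ)) (Finset.mem_univ j), ← mul_assoc]
      congr 1
      · simp [Nat.factorial_succ]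
      · exact Finset.prod_congr rfl fun k hk => by
          simp [Pi.single_eq_of_ne (Finset.ne_of_mem_erase hk)]
    simp only [e2] at h2
    rw [e1] at h1
    rw [← h2, e3]
    change _ * laurentCoeff (fun w => fderiv ℂ (listPartial J f) w (Pi.single j 1)) z _ = _
    rw [h1]
    simp only [Pi.add_apply, Pi.single_eq_same]
    push_cast
    ring

/-- The weight-zero component is constant off the hyperplanes and continuous at `0`, where the torus
orbit is a single point and the average is `f 0`. -/
theorem laurentCoeff_zero_eq (hΩ : IsOpen Ω) (hc : IsPreconnected Ω)
    (hR : IsReinhardt Ω) (hf : DifferentiableOn ℂ f Ω) (hz : z ∈ Ω) (hz0 : ∀ j, z j ≠ 0)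
    (h0 : (0 : Fin n → ℂ) ∈ Ω) : laurentCoeff f z 0 = f 0 := by
  have h1 : laurentTerm f 0 0 = f 0 := by
    simp [laurentTerm_eq_integral, UnitAddTorus.mFourier_zero]
  have hne : (𝓝[{z : Fin n → ℂ | ∀ j, z j ≠ 0}] (0 : Fin n → ℂ)).NeBot :=
    mem_closure_iff_nhdsWithin_neBot.1 (dense_forall_ne_zero 0)
  have h2 : Tendsto (laurentTerm f 0) (𝓝[{z : Fin n → ℂ | ∀ j, z j ≠ 0}] 0) (𝓝 (f 0)) := by
    rw [← h1]
    exact ((differentiableOn_laurentTerm hΩ hR hf 0).continuousOn.continuousAt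
      (hΩ.mem_nhds h0)).tendsto.mono_left nhdsWithin_le_nhds
  refine tendsto_nhds_unique (Tendsto.congr' ?_ tendsto_const_nhds) h2
  filter_upwards [self_mem_nhdsWithin, mem_nhdsWithin_of_mem_nhds (hΩ.mem_nhds h0)] with w hw0 hw
  rw [laurentTerm_eq_laurentCoeff_mul hΩ hc hR hf 0 hz hz0 hw hw0]
  simp [laurentMonomial]

theorem complexPartial_zero_eq (hΩ : IsOpen Ω) (hc : IsPreconnected Ω)
    (hR : IsReinhardt Ω) (hf : DifferentiableOn ℂ f Ω) (hz : z ∈ Ω) (hz0 : ∀ j, z j ≠ 0)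
    (h0 : (0 : Fin n → ℂ) ∈ Ω) (α : Fin n → ℕ) :
    complexPartial α f 0 = (∏ k, ((α k).factorial : ℂ)) * laurentCoeff f z (fun k => α k) := by
  have h := prod_factorial_mul_laurentCoeff_listPartial hΩ hc hR hf hz hz0
    ((List.finRange n).flatMap fun j => List.replicate (α j) j) 0
  simp only [count_flatMap_replicate, Pi.zero_apply, zero_add, Nat.factorial_zero, Nat.cast_one,
    Finset.prod_const_one, one_mul, Nat.cast_zero] at h
  rw [← h, complexPartial_eq_listPartial]
  exact (laurentCoeff_zero_eq hΩ hc hR (differentiableOn_iterDirDeriv hΩ hf _) hz hz0 h0).symm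

end IterDirDeriv

/-! ### Vanishing of the coefficients with a negative exponent. -/

section Vanishing

variable {n : ℕ} {Ω : Set (Fin n → ℂ)} {f : (Fin n → ℂ) → ℂ}

/-- Holomorphic functions all of whose partial derivatives are bounded near the origin. -/
structure HolomorphicBoundedPartials (Ω : Set (Fin n → ℂ)) (f : (Fin n → ℂ) → ℂ) : Prop where
  differentiableOn : DifferentiableOn ℂ f Ω
  bounded : ∀ J : List (Fin n), ∃ M : ℝ, ∀ᶠ z in 𝓝[Ω] 0, ‖listPartial J f z‖ ≤ M

theorem HolomorphicBoundedPartials.fderiv_apply (hΩ : IsOpen Ω)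
    (hf : HolomorphicBoundedPartials Ω f) (j : Fin n) :
    HolomorphicBoundedPartials Ω fun z => fderiv ℂ f z (Pi.single j 1) where
  differentiableOn := differentiableOn_fderiv_apply hΩ hf.differentiableOn _
  bounded J := by
    have h := hf.bounded (J ++ [j])
    simpa only [listPartial, List.map_append, List.map_cons, List.map_nil,
      iterDirDeriv_concat] using h

theorem SmoothUpToBoundary.holomorphicBoundedPartials (hΩ : IsOpen Ω)
    (h0 : (0 : Fin n → ℂ) ∈ closure Ω) (hs : SmoothUpToBoundary Ω f)
    (hf : DifferentiableOn ℂ f Ω) : HolomorphicBoundedPartials Ω f where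
  differentiableOn := hf
  bounded J := by
    obtain ⟨g, hg, hgf⟩ := hs.2 (J.map fun j => Pi.single j 1) fun v hv => by
      obtain ⟨j, -, rfl⟩ := List.mem_map.1 hv
      exact ⟨j, Or.inl rfl⟩
    refine ⟨‖g 0‖ + 1, ?_⟩
    have h1 : Tendsto g (𝓝[Ω] 0) (𝓝 (g 0)) := (hg 0 h0).mono subset_closure
    filter_upwards [h1.norm.eventually (Iic_mem_nhds (lt_add_one ‖g 0‖)),
      self_mem_nhdsWithin] with z hz hzΩ
    rw [listPartial, ← eqOn_iterDirDeriv_real_complex hΩ hf _ hzΩ, ← hgf hzΩ]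
    exact hz

/-- The sup norm is invariant under the torus, so the average only sees points of `Ω` equally close
to `0`. -/
theorem exists_norm_laurentTerm_le (hR : IsReinhardt Ω) {M : ℝ}
    (hM : ∀ᶠ z in 𝓝[Ω] 0, ‖f z‖ ≤ M) (α : Fin n → ℤ) :
    ∀ᶠ z in 𝓝[Ω] 0, ‖laurentTerm f α z‖ ≤ M := by
  obtain ⟨δ, hδ, h⟩ := Metric.mem_nhdsWithin_iff.1 hM
  filter_upwards [mem_nhdsWithin_of_mem_nhds (ball_mem_nhds 0 hδ), self_mem_nhdsWithin]
    with z hz hzΩ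
  refine norm_laurentTerm_le (fun t => h ⟨?_, hR.torusMul_mem hzΩ t⟩) α
  rwa [mem_ball_zero_iff, norm_torusMul, ← mem_ball_zero_iff]

theorem inv_norm_le_norm_laurentMonomial {α : Fin n → ℤ} (hα : ∀ j, α j ≤ 0) {k : Fin n}
    (hk : α k < 0) {z : Fin n → ℂ} (hz0 : ∀ j, z j ≠ 0) (hz : ‖z‖ ≤ 1) :
    ‖z‖⁻¹ ≤ ‖laurentMonomial α z‖ := by
  have hpos : ∀ j, 0 < ‖z j‖ := fun j => norm_pos_iff.2 (hz0 j)
  have hle : ∀ j, ‖z j‖ ≤ 1 := fun j => (norm_le_pi_norm z j).trans hz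
  simp only [laurentMonomial, norm_prod, norm_zpow]
  rw [← Finset.mul_prod_erase _ _ (Finset.mem_univ k)]
  have h1 : ‖z‖⁻¹ ≤ ‖z k‖ ^ α k := by
    calc ‖z‖⁻¹ ≤ ‖z k‖⁻¹ := inv_anti₀ (hpos k) (norm_le_pi_norm z k)
      _ = ‖z k‖ ^ (-1 : ℤ) := (zpow_neg_one _).symm
      _ ≤ _ := zpow_le_zpow_right_of_le_one₀ (hpos k) (hle k) (by omega)
  have h2 : 1 ≤ ∏ j ∈ Finset.univ.erase k, ‖z j‖ ^ α j :=
    Finset.prod_induction _ (1 ≤ ·) (fun _ _ => one_le_mul_of_one_le_of_one_le) le_rfl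
      fun j _ => one_le_zpow_of_nonpos₀ (hpos j) (hle j) (hα j)
  exact h1.trans (le_mul_of_one_le_right ((inv_nonneg.2 (norm_nonneg z)).trans h1) h2)

/-- The Laurent coefficients with a negative exponent vanish. -/
theorem laurentCoeff_eq_zero (hΩ : IsOpen Ω) (hc : IsPreconnected Ω) (hR : IsReinhardt Ω)
    (h0 : (0 : Fin n → ℂ) ∈ closure Ω) (hf : HolomorphicBoundedPartials Ω f) {α : Fin n → ℤ}
    (hα : ∃ k, α k < 0) {z : Fin n → ℂ} (hz : z ∈ Ω) (hz0 : ∀ j, z j ≠ 0) :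
    laurentCoeff f z α = 0 := by
  classical
  obtain ⟨k, hk⟩ := hα
  -- The induction is on the sum of the positive exponents, with `f` free so that it can be replaced
  -- by a partial derivative.
  induction hN : ∑ j, (α j).toNat generalizing α f with
  | zero =>
    have hle : ∀ j, α j ≤ 0 := fun j =>
      Int.toNat_eq_zero.1 (Finset.sum_eq_zero_iff.1 hN j (Finset.mem_univ j))
    obtain ⟨M, hM⟩ : ∃ M : ℝ, ∀ᶠ z in 𝓝[Ω] 0, ‖f z‖ ≤ M := hf.bounded []
    set S : Set (Fin n → ℂ) := Ω ∩ {z | ∀ j, z j ≠ 0}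
    have hne : (𝓝[S] (0 : Fin n → ℂ)).NeBot := mem_closure_iff_nhdsWithin_neBot.1
      (closure_minimal (dense_forall_ne_zero.open_subset_closure_inter hΩ) isClosed_closure h0)
    -- From `‖c_α‖ / ‖w‖ ≤ ‖c_α w^α‖ ≤ M`; letting `w → 0` gives `c_α = 0`.
    have hev : ∀ᶠ w in 𝓝[S] 0, ‖laurentCoeff f z α‖ ≤ M * ‖w‖ := by
      filter_upwards [(exists_norm_laurentTerm_le hR hM α).filter_mono
        (nhdsWithin_mono _ inter_subset_left), self_mem_nhdsWithin,
        mem_nhdsWithin_of_mem_nhds (closedBall_mem_nhds 0 one_pos)] with w hw hwS hw1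
      rw [laurentTerm_eq_laurentCoeff_mul hΩ hc hR hf.differentiableOn α hz hz0 hwS.1 hwS.2,
        norm_mul] at hw
      have hw1' : ‖w‖ ≤ 1 := by simpa using hw1
      have hwpos : 0 < ‖w‖ := (norm_pos_iff.2 (hwS.2 k)).trans_le (norm_le_pi_norm w k)
      have h3 := (mul_le_mul_of_nonneg_left
        (inv_norm_le_norm_laurentMonomial hle hk hwS.2 hw1') (norm_nonneg _)).trans hw
      rwa [← div_eq_mul_inv, div_le_iff₀ hwpos] at h3
    have hlim : Tendsto (fun w : Fin n → ℂ => M * ‖w‖) (𝓝[S] 0) (𝓝 0) := by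
      have : Tendsto (fun w : Fin n → ℂ => M * ‖w‖) (𝓝 0) (𝓝 (M * ‖(0 : Fin n → ℂ)‖)) :=
        Continuous.tendsto (by fun_prop) 0
      simpa using this.mono_left nhdsWithin_le_nhds
    exact norm_le_zero_iff.1 (ge_of_tendsto hlim hev)
  | succ N ih =>
    obtain ⟨j, hj⟩ : ∃ j, 0 < α j := by
      by_contra! h
      have : ∑ j, (α j).toNat = 0 := Finset.sum_eq_zero fun j _ => Int.toNat_of_nonpos (h j)
      omega
    -- The negative exponent at `k` is untouched by lowering `α j`.
    have hkj : k ≠ j := by rintro rfl; omega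
    have h1 := ih (hf.fderiv_apply hΩ j) (α := α - Pi.single j 1)
      (by simpa [Pi.single_eq_of_ne hkj] using hk) (by
        rw [← Finset.add_sum_erase _ _ (Finset.mem_univ j)] at hN ⊢
        have : ∑ i ∈ Finset.univ.erase j, ((α - Pi.single j 1 : Fin n → ℤ) i).toNat =
            ∑ i ∈ Finset.univ.erase j, (α i).toNat :=
          Finset.sum_congr rfl fun i hi => by simp [Pi.single_eq_of_ne (Finset.ne_of_mem_erase hi)]
        rw [this]
        simp only [Pi.sub_apply, Pi.single_eq_same]
        omega)
    rw [laurentCoeff_fderiv hΩ hc hR hf.differentiableOn α hz hz0 j] at h1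
    exact (mul_eq_zero.1 h1).resolve_left (Int.cast_ne_zero.2 hj.ne')

end Vanishing

/-! ### Power series expansion of `f` on `Ω`. -/

section Expansion

variable {n : ℕ} {Ω : Set (Fin n → ℂ)} {f : (Fin n → ℂ) → ℂ} {z : Fin n → ℂ}

/-- Near `x` there is `w ∈ Ω` with all moduli strictly larger. The terms at `w` are bounded by the
maximum of `‖f‖` on the torus through `w`. -/
theorem subset_interior_boundedTermSet (hΩ : IsOpen Ω) (hc : IsPreconnected Ω)
    (hR : IsReinhardt Ω) (hf : DifferentiableOn ℂ f Ω) (hz : z ∈ Ω) (hz0 : ∀ j, z j ≠ 0) :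
    Ω ⊆ interior (boundedTermSet fun α : Fin n → ℕ => laurentCoeff f z fun k => α k) := by
  intro x hx
  obtain ⟨ε, hε, w, hw, hwx⟩ := exists_mem_norm_eq_norm_add (hΩ.mem_nhds hx)
  have hw0 : ∀ j, w j ≠ 0 := fun j => norm_pos_iff.1 (by rw [hwx]; positivity)
  refine (isCompleteReinhardt_boundedTermSet _).mem_interior_of_norm_lt (w := w) ?_
    fun j => by linarith [hwx j]
  have hcont : Continuous fun t => f (torusMul t w) :=
    hf.continuousOn.comp_continuous (continuous_torusMul.comp (Continuous.prodMk_right w))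
      fun t => hR.torusMul_mem hw t
  obtain ⟨M, hM⟩ := isCompact_univ.exists_bound_of_continuousOn hcont.continuousOn
  refine ⟨M, fun α => ?_⟩
  have h := norm_laurentTerm_le (fun t => hM t (mem_univ t)) fun k => (α k : ℤ)
  rw [laurentTerm_eq_laurentCoeff_mul hΩ hc hR hf _ hz hz0 hw hw0, norm_mul] at h
  simpa [laurentMonomial] using h

/-- A Laurent series without negative exponents is a power series. -/
theorem eq_tsum_laurentCoeff (hΩ : IsOpen Ω) (hc : IsPreconnected Ω)
    (hR : IsReinhardt Ω) (hf : DifferentiableOn ℂ f Ω) (hz : z ∈ Ω) (hz0 : ∀ j, z j ≠ 0)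
    (hneg : ∀ α : Fin n → ℤ, (∃ k, α k < 0) → laurentCoeff f z α = 0) :
    EqOn (fun w => ∑' α : Fin n → ℕ, laurentCoeff f z (fun k => α k) * ∏ j, w j ^ α j) f Ω := by
  have hsub := subset_interior_boundedTermSet hΩ hc hR hf hz hz0
  have hmain : EqOn (fun w => ∑' α : Fin n → ℕ, laurentCoeff f z (fun k => α k) *
      ∏ j, w j ^ α j) f (Ω ∩ {z | ∀ j, z j ≠ 0}) := by
    rintro w ⟨hw, hw0⟩
    set ι : (Fin n → ℕ) → Fin n → ℤ := fun α k => α k with hι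
    have hinj : Function.Injective ι := fun α β h => funext fun k => by
      have := congrFun h k
      simpa [hι] using this
    have hrange : ∀ α ∉ range ι, laurentTerm f α w = 0 := by
      intro α hα
      rw [laurentTerm_eq_laurentCoeff_mul hΩ hc hR hf _ hz hz0 hw hw0, hneg α, zero_mul]
      by_contra! h
      exact hα ⟨fun k => (α k).toNat, funext fun k => Int.toNat_of_nonneg (h k)⟩
    have hterm : ∀ α, laurentTerm f (ι α) w =
        laurentCoeff f z (fun k => α k) * ∏ j, w j ^ α j := by
      intro α
      rw [laurentTerm_eq_laurentCoeff_mul hΩ hc hR hf _ hz hz0 hw hw0]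
      simp [laurentMonomial, hι]
    have hs : Summable fun α => laurentTerm f α w := by
      rw [← hinj.summable_iff hrange]
      exact (summable_of_mem_interior_boundedTermSet _ (hsub hw)).congr fun α => (hterm α).symm
    let G : C(UnitAddTorus (Fin n), ℂ) := ⟨fun t => f (torusMul t w),
      hf.continuousOn.comp_continuous (continuous_torusMul.comp (Continuous.prodMk_right w))
        fun t => hR.torusMul_mem hw t⟩
    have hsum : HasSum (fun α => laurentTerm f α w) (f w) := by
      -- The Laurent series at `w` is the Fourier series of `t ↦ f (torusMul t w)` evaluated at `t =
      -- 0`.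
      have h := UnitAddTorus.hasSum_mFourier_series_apply_of_summable (f := G) hs 0
      have e : ∀ α : Fin n → ℤ, UnitAddTorus.mFourier α 0 = 1 := fun α => by
        simp [UnitAddTorus.mFourier]
      simp only [e, smul_eq_mul, mul_one] at h
      have hG : G 0 = f w := congrArg f (torusMul_zero w)
      rw [hG] at h
      exact h
    rw [← hinj.hasSum_iff hrange] at hsum
    have := hsum.tsum_eq
    simp only [Function.comp_def, hterm] at this
    exact this
  -- Points on the hyperplanes follow by continuity of both sides and density.
  have hcF := ((differentiableOn_tsum_monomial _).mono hsub).continuousOn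
  intro x hx
  have hne : (𝓝[Ω ∩ {z | ∀ j, z j ≠ 0}] x).NeBot := mem_closure_iff_nhdsWithin_neBot.1
    (dense_forall_ne_zero.open_subset_closure_inter hΩ hx)
  have h1 := (hcF x hx).mono (inter_subset_left (t := {z : Fin n → ℂ | ∀ j, z j ≠ 0}))
  have h2 := (hf.continuousOn x hx).mono (inter_subset_left (t := {z : Fin n → ℂ | ∀ j, z j ≠ 0}))
  exact tendsto_nhds_unique (h1.tendsto.congr' (hmain.eventuallyEq_of_mem self_mem_nhdsWithin))
    h2.tendsto

end Expansion

/-! ### The extension theorem. -/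

theorem mainTheorem2 (n : ℕ) (Ω : Set (Fin n → ℂ))
    (hΩ : IsDomainSet Ω) (hR : IsReinhardt Ω) (h0 : (0 : Fin n → ℂ) ∈ frontier Ω) :
    ∃ D : Set (Fin n → ℂ),
      IsLeast {D' : Set (Fin n → ℂ) | IsCompleteLogConvexReinhardtDomain D' ∧ Ω ⊆ D'} D ∧
      ∀ f : (Fin n → ℂ) → ℂ, SmoothUpToBoundary Ω f → DifferentiableOn ℂ f Ω →
        ∃ F : (Fin n → ℂ) → ℂ,
          DifferentiableOn ℂ F D ∧ EqOn F f Ω ∧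
          (∀ α : Fin n → ℕ,
            Tendsto (complexPartial α f) (𝓝[Ω] 0) (𝓝 (complexPartial α F 0))) ∧
          ∀ z ∈ D, HasSum
            (fun α : Fin n → ℕ =>
              complexPartial α F 0 / (∏ j, ((α j).factorial : ℂ)) * ∏ j, z j ^ α j)
            (F z) := by
  obtain ⟨hΩo, hΩc⟩ := hΩ
  have hleast := isLeast_reinhardtHull hΩo hΩc.nonempty
  refine ⟨reinhardtHull Ω, hleast, fun f hs hf => ?_⟩
  obtain ⟨⟨⟨hDo, hDc⟩, hDR, hDC, -⟩, hΩD⟩ := hleast.1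
  have h0c : (0 : Fin n → ℂ) ∈ closure Ω := frontier_subset_closure h0
  obtain ⟨z, hz, hz0⟩ := dense_forall_ne_zero.inter_open_nonempty Ω hΩo hΩc.nonempty
  have hneg := fun α hα => laurentCoeff_eq_zero hΩo hΩc.isPreconnected hR h0c
    (hs.holomorphicBoundedPartials hΩo h0c hf) (α := α) hα hz hz0
  set c : (Fin n → ℕ) → ℂ := fun α => laurentCoeff f z fun k => α k with hcdef
  have hsub := subset_interior_boundedTermSet hΩo hΩc.isPreconnected hR hf hz hz0
  -- Minimality of the hull, tested against the convergence domain of this particular `f`.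
  have hDsub : reinhardtHull Ω ⊆ interior (boundedTermSet c) :=
    hleast.2 ⟨(isCompleteReinhardt_boundedTermSet c).isCompleteLogConvexReinhardtDomain_interior
      (isLogConvex_boundedTermSet c) (hΩc.nonempty.mono hsub), hsub⟩
  set F : (Fin n → ℂ) → ℂ := fun w => ∑' α, c α * ∏ j, w j ^ α j with hFdef
  have hFd : DifferentiableOn ℂ F (reinhardtHull Ω) :=
    (differentiableOn_tsum_monomial c).mono hDsub
  have hFf : EqOn F f Ω := eq_tsum_laurentCoeff hΩo hΩc.isPreconnected hR hf hz hz0 hneg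
  have h0D : (0 : Fin n → ℂ) ∈ reinhardtHull Ω := hDC.zero_mem hDc.nonempty
  -- `F` and `f` agree on the torus through `z`, so they share coefficients; for `F` these can be
  -- read off at `0`, which lies in the hull.
  have hcF : ∀ α : Fin n → ℕ, laurentCoeff F z (fun k => α k) = c α := by
    intro α
    have : (fun t => F (torusMul t z)) = fun t => f (torusMul t z) :=
      funext fun t => hFf (hR.torusMul_mem hz t)
    simp only [hcdef, laurentCoeff, laurentTerm, this]
  have hcoef : ∀ α, complexPartial α F 0 = (∏ k, ((α k).factorial : ℂ)) * c α := by
    intro α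
    rw [complexPartial_zero_eq hDo hDc.isPreconnected hDR hFd (hΩD hz) hz0 h0D, hcF]
  refine ⟨F, hFd, hFf, fun α => ?_, fun w hw => ?_⟩
  · have h1 : Tendsto (complexPartial α F) (𝓝[Ω] 0) (𝓝 (complexPartial α F 0)) :=
      ((differentiableOn_iterDirDeriv hDo hFd _).continuousOn.continuousAt
        (hDo.mem_nhds h0D)).tendsto.mono_left nhdsWithin_le_nhds
    exact h1.congr' ((eqOn_iterDirDeriv hΩo hFf _).eventuallyEq_of_mem self_mem_nhdsWithin)
  · have h1 := (summable_of_mem_interior_boundedTermSet c (hDsub hw)).hasSum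
    refine h1.congr_fun fun α => ?_
    rw [hcoef, mul_div_cancel_left₀]
    exact Finset.prod_ne_zero_iff.2 fun k _ => Nat.cast_ne_zero.2 (Nat.factorial_ne_zero _)
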